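/- Let $A\in\mathbb R$, $\sigma_x,\sigma_v>0$, let $h:\mathbb R\to\mathbb R$ be measurable with $0\le h\le A$, and let $v$ be a real random variable (the noise) with mean $0$ and variance $\sigma_v^2$, of otherwise arbitrary law. For a zero-mean real random variable $x$ with variance $\sigma_x^2$, independent of $v$, consider the channel $y=h(x)+v$ and put $$\alpha=\frac{E[x\,h(x)]}{E[x^2]},\qquad d=h(x)-\alpha x,\qquad \varepsilon_d=E[d^2]-(E[d])^2,\qquad \mathrm{SNDR}=\frac{\alpha^2\sigma_x^2}{\varepsilon_d+\sigma_v^2}.$$ Let $I(y;x)\in[0,\infty]$ be the mutual information (the Kullback–Leibler divergence of the joint law of $(y,x)$ from the product of its marginals) and $H(x)\in[-\infty,\infty)$ the differential entropy of $x$ ($-\infty$ if $x$ has no density), both with natural logarithms. 1. For every such $x$, $$I(y;x)\ \ge\ H(x)-\tfrac12\log(2\pi e\,\sigma_x^2)+\tfrac12\log(1+\mathrm{SNDR}).$$ 2. Let $\mathrm{SNDR}_G$ be the SNDR of a Gaussian input $x\sim N(0,\sigma_x^2)$. Then $$C\ \ge\ \tfrac12\log(1+\mathrm{SNDR}_G)$$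 for each of the following capacities $C$ of the channel: the supremum of $I(h(x)+v;x)$ over the laws of zero-mean inputs $x$ with variance $\sigma_x^2$; its supremum over all laws of $x$; and the supremum of $I(\tilde h(x)+v;x)$ over all laws of $x$ and all measurable $\tilde h$ with $0\le\tilde h\le A$ (where $x$ is always independent of $v$). -/

import Mathlib

open MeasureTheory ProbabilityTheory
open scoped ENNReal NNReal

noncomputable section

namespace DynRange

/-- Mutual information `I(X;Y)` (in nats) of two real random variables: the Kullback-Leibler
divergence of the joint law from the product of the marginal laws. Values in `[0, ∞]`. -/
def mutualInfo {Ω : Type*} [MeasurableSpace Ω] (P : Measure Ω) (X Y : Ω → ℝ) : ℝ≥0∞ :=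
  InformationTheory.klDiv (P.map (fun ω => (X ω, Y ω))) ((P.map X).prod (P.map Y))

open Classical in
/-- Differential entropy (in nats) `-∫ f log f` of a law `μ` on `ℝ` with Lebesgue density `f`,
as an extended real number: the integral of the positive part of `-f log f` minus the integral of
its negative part. (For a law of finite variance the first integral is always finite.)
A law without a density has entropy `-∞`, as usual. -/
def differentialEntropy (μ : Measure ℝ) : EReal :=
  if μ ≪ volume then
    ((∫⁻ t, ENNReal.ofReal (Real.negMulLog (μ.rnDeriv volume t).toReal) : ℝ≥0∞) : EReal)
      - ((∫⁻ t, ENNReal.ofReal (-Real.negMulLog (μ.rnDeriv volume t).toReal) : ℝ≥0∞) : EReal)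
  else ⊥

/-- Bussgang gain `α = E[x h(x)] / E[x²]` for an input of law `μ`. -/
def gain (μ : Measure ℝ) (h : ℝ → ℝ) : ℝ :=
  (∫ t, t * h t ∂μ) / ∫ t, t ^ 2 ∂μ

/-- Distortion `d = h(x) - α x`. -/
def distortion (μ : Measure ℝ) (h : ℝ → ℝ) (t : ℝ) : ℝ :=
  h t - gain μ h * t

/-- Distortion power `ε_d = E[d²] - (E[d])²`. -/
def distortionPower (μ : Measure ℝ) (h : ℝ → ℝ) : ℝ :=
  (∫ t, distortion μ h t ^ 2 ∂μ) - (∫ t, distortion μ h t ∂μ) ^ 2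

/-- `SNDR = α² σ_x² / (ε_d + σ_v²)` for an input of law `μ`, the mapping `h` and the noise
power `noisePower = σ_v²`. -/
def sndr (μ : Measure ℝ) (h : ℝ → ℝ) (noisePower : ℝ) : ℝ :=
  gain μ h ^ 2 * Var[id; μ] / (distortionPower μ h + noisePower)

/-- The information rate `I(y;x)` of `y = h(x) + v` for an input `x` of law `μ` and an independent
noise `v` of law `ν`. -/
def informationRate (h : ℝ → ℝ) (ν μ : Measure ℝ) : ℝ≥0∞ :=
  mutualInfo (μ.prod ν) (fun p => h p.1 + p.2) (fun p => p.1)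

/-- The zero-mean laws on `ℝ` with variance `s`. -/
def zeroMeanLaws (s : ℝ) : Set (Measure ℝ) :=
  {μ | IsProbabilityMeasure μ ∧ MemLp id 2 μ ∧ ∫ t, t ∂μ = 0 ∧ Var[id; μ] = s}

/-- Capacity of `y = h(x) + v` over the zero-mean inputs of variance `s`. -/
def capacityWithPower (h : ℝ → ℝ) (ν : Measure ℝ) (s : ℝ) : ℝ≥0∞ :=
  ⨆ μ ∈ zeroMeanLaws s, informationRate h ν μ

/-- Capacity `sup_{p_x} I(y;x)` of `y = h(x) + v` over all input laws. -/
def capacity (h : ℝ → ℝ) (ν : Measure ℝ) : ℝ≥0∞ :=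
  ⨆ μ ∈ {μ : Measure ℝ | IsProbabilityMeasure μ}, informationRate h ν μ

/-- The measurable mappings with dynamic range constraint `0 ≤ h ≤ A`. -/
def rangeLimited (A : ℝ) : Set (ℝ → ℝ) :=
  {h | Measurable h ∧ ∀ t, 0 ≤ h t ∧ h t ≤ A}

/-- Capacity of the dynamic range constrained channel, `sup_{p_x, h} I(y;x)` subject to
`0 ≤ h ≤ A`. -/
def dynamicRangeCapacity (A : ℝ) (ν : Measure ℝ) : ℝ≥0∞ :=
  ⨆ h ∈ rangeLimited A, capacity h ν

end DynRange

end

namespace DynRange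

/-! The mutual information is bounded below by a Gaussian auxiliary channel. For any affine estimate
`a + b y` of `x` with mean square error `m`, let `g` be the Gaussian density of variance `m` centred
at the estimate, and let `f` be the density of `x`. The test function `log (g / f)` in the
Donsker–Varadhan bound has mean `H(x) - ½ log (2πe m)` under the joint law, and its exponential
integrates to at most 1 under the product law (`ofReal_entropy_sub_le_mutualInfo`). No Gaussianity
of the noise enters: only second moments matter.

The best affine estimate has `m = σx² - cov(x,y)² / Var y`. Since `αx` is the regression of `h(x)`
on `x`, this equals `σx² / (1 + SNDR)`, which gives part 1. For a Gaussian input the entropy gap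
vanishes, and each capacity dominates that one rate. -/

/-- Donsker–Varadhan lower bound for the Kullback–Leibler divergence. -/
theorem ofReal_integral_le_klDiv {α : Type*} {mα : MeasurableSpace α} {μ ν : Measure α}
    [IsProbabilityMeasure μ] [IsProbabilityMeasure ν] {φ : α → ℝ} (hφ : Integrable φ μ)
    (hexp : Integrable (fun a => Real.exp (φ a)) ν) (hle : ∫ a, Real.exp (φ a) ∂ν ≤ 1) :
    ENNReal.ofReal (∫ a, φ a ∂μ) ≤ InformationTheory.klDiv μ ν := by
  by_cases hμν : μ ≪ ν
  swap
  · simp [InformationTheory.klDiv_of_not_ac hμν]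
  by_cases hint : Integrable (llr μ ν) μ
  swap
  · simp [InformationTheory.klDiv_of_not_integrable hint]
  rw [InformationTheory.klDiv_of_ac_of_integrable hμν hint]
  refine ENNReal.ofReal_le_ofReal ?_
  -- The divergence of `μ` from `ν` tilted by `φ` is nonnegative, and it equals `∫ llr μ ν ∂μ - ∫ φ
  -- ∂μ + log ∫ exp φ ∂ν`.
  have := isProbabilityMeasure_tilted hexp
  have h0 := InformationTheory.integral_llr_add_sub_measure_univ_nonneg
    (hμν.trans (absolutelyContinuous_tilted hexp))
    (integrable_llr_tilted_right hμν hφ hint hexp)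
  have hlog : Real.log (∫ a, Real.exp (φ a) ∂ν) ≤ 0 :=
    Real.log_nonpos (integral_nonneg fun a => (Real.exp_pos _).le) hle
  rw [integral_llr_tilted_right hμν hφ hexp hint] at h0
  simp only [probReal_univ] at h0 ⊢
  linarith

theorem log_gaussianPDFReal (μ : ℝ) {m : ℝ≥0} (hm : m ≠ 0) (t : ℝ) :
    Real.log (gaussianPDFReal μ m t)
      = -(1 / 2 * Real.log (2 * Real.pi * m)) - (t - μ) ^ 2 / (2 * m) := by
  have hm' : (0 : ℝ) < m := by positivity
  rw [gaussianPDFReal, Real.log_mul (by positivity) (Real.exp_ne_zero _), Real.log_exp,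
    Real.log_inv, Real.log_sqrt (by positivity)]
  ring

/-! ### Densities and differential entropy -/

section Density

variable {μ : Measure ℝ}

theorem integrable_log_density_iff [SigmaFinite μ] (hμ : μ ≪ volume) :
    Integrable (fun t => Real.log (μ.rnDeriv volume t).toReal) μ ↔
      Integrable fun t => Real.negMulLog (μ.rnDeriv volume t).toReal := by
  rw [← integrable_rnDeriv_smul_iff hμ, ← integrable_neg_iff]
  refine integrable_congr (ae_of_all _ fun t => ?_)
  simp [Real.negMulLog]

theorem integral_log_density [SigmaFinite μ] (hμ : μ ≪ volume) :
    ∫ t, Real.log (μ.rnDeriv volume t).toReal ∂μ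
      = -∫ t, Real.negMulLog (μ.rnDeriv volume t).toReal := by
  rw [← integral_rnDeriv_smul hμ, ← integral_neg]
  simp [Real.negMulLog]

/-- Against `f dt` the factor `1 / f` cancels the density wherever `f > 0`. Only an inequality
survives, because the mass of `g` on `{f = 0}` is lost. -/
theorem lintegral_mul_exp_neg_log_density_le [IsFiniteMeasure μ] (hμ : μ ≪ volume)
    {g : ℝ → ℝ≥0∞} (hg : Measurable g) :
    ∫⁻ t, g t * ENNReal.ofReal (Real.exp (-Real.log (μ.rnDeriv volume t).toReal)) ∂μ
      ≤ ∫⁻ t, g t := by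
  rw [← lintegral_rnDeriv_mul hμ (by fun_prop)]
  refine lintegral_mono_ae ?_
  filter_upwards [μ.rnDeriv_lt_top volume] with t ht
  rcases eq_or_ne (μ.rnDeriv volume t) 0 with h0 | h0
  · simp [h0]
  · have hpos : 0 < (μ.rnDeriv volume t).toReal := ENNReal.toReal_pos h0 ht.ne
    rw [Real.exp_neg, Real.exp_log hpos, ENNReal.ofReal_inv_of_pos hpos,
      ENNReal.ofReal_toReal ht.ne, mul_left_comm, ENNReal.mul_inv_cancel h0 ht.ne, mul_one]

/-- The positive part of `-f log f` is integrable when `f` is a density of finite variance. -/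
theorem lintegral_negMulLog_density_ne_top [IsFiniteMeasure μ] (hμ : μ ≪ volume)
    (hmem : MemLp id 2 μ) :
    ∫⁻ t, ENNReal.ofReal (Real.negMulLog (μ.rnDeriv volume t).toReal) ≠ ∞ := by
  set f : ℝ → ℝ := fun t => (μ.rnDeriv volume t).toReal with hf
  set c : ℝ := 1 / 2 * Real.log (2 * Real.pi * (1 : ℝ≥0)) with hc
  -- The dominating function comes from `log u ≤ u - 1` at `u = γ / f`, with `γ` the standard
  -- Gaussian density and `-log γ = c + t² / 2`. The second moment makes it integrable.
  have hbound : Integrable fun t => gaussianPDFReal 0 1 t + f t • (c + t ^ 2 / 2) := by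
    refine (integrable_gaussianPDFReal 0 1).add ?_
    rw [integrable_rnDeriv_smul_iff hμ]
    exact (integrable_const _).add (hmem.integrable_sq.div_const 2)
  refine ((lintegral_mono fun t => ENNReal.ofReal_le_ofReal ?_).trans_lt
    hbound.lintegral_lt_top).ne
  have hg := gaussianPDFReal_pos 0 1 t one_ne_zero
  have hft : 0 ≤ f t := ENNReal.toReal_nonneg
  rcases hft.eq_or_lt with h0 | h0
  · simp only [hf] at h0
    simp [hf, ← h0, hg.le]
  · have h1 := Real.log_le_sub_one_of_pos (div_pos hg h0)
    rw [Real.log_div hg.ne' h0.ne', log_gaussianPDFReal 0 one_ne_zero t, ← hc] at h1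
    have h2 := mul_le_mul_of_nonneg_left h1 hft
    have h3 : f t * (gaussianPDFReal 0 1 t / f t - 1) = gaussianPDFReal 0 1 t - f t := by
      field_simp
    rw [h3] at h2
    simp only [Real.negMulLog, smul_eq_mul, NNReal.coe_one] at h2 ⊢
    linarith

theorem differentialEntropy_of_integrable (hμ : μ ≪ volume)
    (hint : Integrable fun t => Real.negMulLog (μ.rnDeriv volume t).toReal) :
    differentialEntropy μ
      = ((∫ t, Real.negMulLog (μ.rnDeriv volume t).toReal : ℝ) : EReal) := by
  rw [differentialEntropy, if_pos hμ, integral_eq_lintegral_pos_part_sub_lintegral_neg_part hint,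
    EReal.coe_sub, EReal.coe_ennreal_toReal hint.lintegral_lt_top.ne,
    EReal.coe_ennreal_toReal]
  exact (Integrable.lintegral_lt_top hint.neg).ne

/-- A law of finite variance has entropy `-∞` unless `f log f` is integrable. -/
theorem differentialEntropy_eq_bot_of_not_integrable [IsFiniteMeasure μ] (hmem : MemLp id 2 μ)
    (hint : ¬ (μ ≪ volume ∧ Integrable fun t => Real.negMulLog (μ.rnDeriv volume t).toReal)) :
    differentialEntropy μ = ⊥ := by
  by_cases hμ : μ ≪ volume
  swap
  · rw [differentialEntropy, if_neg hμ]
  -- The positive part always has finite integral, so integrability can only fail through the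
  -- negative part.
  have htop : ∫⁻ t, ENNReal.ofReal (-Real.negMulLog (μ.rnDeriv volume t).toReal) = ∞ := by
    by_contra hne
    refine hint ⟨hμ, Measurable.aestronglyMeasurable ?_, ?_⟩
    · exact Real.continuous_negMulLog.measurable.comp (μ.measurable_rnDeriv volume).ennreal_toReal
    · rw [hasFiniteIntegral_iff_norm]
      calc ∫⁻ t, ENNReal.ofReal ‖Real.negMulLog (μ.rnDeriv volume t).toReal‖
          ≤ ∫⁻ t, (ENNReal.ofReal (Real.negMulLog (μ.rnDeriv volume t).toReal)
              + ENNReal.ofReal (-Real.negMulLog (μ.rnDeriv volume t).toReal)) := by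
            refine lintegral_mono fun t => ?_
            rw [Real.norm_eq_abs]
            rcases abs_choice (Real.negMulLog (μ.rnDeriv volume t).toReal) with h | h <;>
              rw [h] <;> simp
        _ = _ := lintegral_add_left (Real.continuous_negMulLog.measurable.comp
              (μ.measurable_rnDeriv volume).ennreal_toReal).ennreal_ofReal _
        _ < ∞ := ENNReal.add_lt_top.2
              ⟨(lintegral_negMulLog_density_ne_top hμ hmem).lt_top, Ne.lt_top hne⟩
  rw [differentialEntropy, if_pos hμ, htop, EReal.coe_ennreal_top, EReal.sub_top]

end Density

theorem differentialEntropy_gaussianReal (μ : ℝ) {s : ℝ≥0} (hs : s ≠ 0) :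
    differentialEntropy (gaussianReal μ s)
      = ((1 / 2 * Real.log (2 * Real.pi * Real.exp 1 * s) : ℝ) : EReal) := by
  have hs' : (0 : ℝ) < s := by positivity
  have hac := gaussianReal_absolutelyContinuous μ hs
  have hlog : (fun t => Real.log ((gaussianReal μ s).rnDeriv volume t).toReal)
      =ᵐ[gaussianReal μ s]
        fun t => -(1 / 2 * Real.log (2 * Real.pi * s)) - (t - μ) ^ 2 / (2 * s) := by
    filter_upwards [hac.ae_le (rnDeriv_gaussianReal μ s)] with t ht
    rw [ht, toReal_gaussianPDF, log_gaussianPDFReal μ hs]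
  have hsq : Integrable (fun t => (t - μ) ^ 2) (gaussianReal μ s) :=
    ((memLp_id_gaussianReal 2).sub (memLp_const μ)).integrable_sq
  have hvar : ∫ t, (t - μ) ^ 2 ∂(gaussianReal μ s) = s := by
    have h := variance_fun_id_gaussianReal (μ := μ) (v := s)
    rwa [variance_eq_integral (by fun_prop), integral_id_gaussianReal] at h
  have hint := (integrable_log_density_iff hac).1
    ((integrable_congr hlog).2 ((integrable_const _).sub (hsq.div_const _)))
  rw [differentialEntropy_of_integrable hac hint, EReal.coe_eq_coe_iff,
    ← neg_eq_iff_eq_neg.2 (integral_log_density hac), integral_congr_ae hlog,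
    integral_sub (integrable_const _) (hsq.div_const _), integral_div, hvar,
    mul_right_comm _ (Real.exp 1), Real.log_mul (by positivity) (Real.exp_ne_zero _), Real.log_exp]
  simp
  field_simp
  ring

/-! ### Mutual information and mean square error -/

section Channel

variable {Ω : Type*} [MeasurableSpace Ω] {P : Measure Ω} [IsProbabilityMeasure P]

/-- Lower bound for the mutual information by the mean square error `m` of an affine estimate
of `x` from `y`. -/
theorem ofReal_entropy_sub_le_mutualInfo {x y : Ω → ℝ} (hx : MemLp x 2 P) (hy : MemLp y 2 P)
    (hac : P.map x ≪ volume)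
    (hint : Integrable fun t => Real.negMulLog ((P.map x).rnDeriv volume t).toReal)
    (a b : ℝ) {m : ℝ≥0} (hm : m ≠ 0) (hmse : ∫ ω, (x ω - (a + b * y ω)) ^ 2 ∂P = m) :
    ENNReal.ofReal ((∫ t, Real.negMulLog ((P.map x).rnDeriv volume t).toReal)
        - 1 / 2 * Real.log (2 * Real.pi * Real.exp 1 * m)) ≤ mutualInfo P y x := by
  have hm' : (0 : ℝ) < m := by positivity
  have hxm := hx.aestronglyMeasurable.aemeasurable
  have hym := hy.aestronglyMeasurable.aemeasurable
  have : IsProbabilityMeasure (P.map x) := Measure.isProbabilityMeasure_map hxm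
  have : IsProbabilityMeasure (P.map y) := Measure.isProbabilityMeasure_map hym
  have : IsProbabilityMeasure (P.map fun ω => (y ω, x ω)) :=
    Measure.isProbabilityMeasure_map (hym.prodMk hxm)
  set L : ℝ → ℝ := fun t => Real.log ((P.map x).rnDeriv volume t).toReal with hL
  have hLm : Measurable L :=
    Real.measurable_log.comp ((P.map x).measurable_rnDeriv volume).ennreal_toReal
  set g : ℝ → ℝ → ℝ := fun s t => gaussianPDFReal (a + b * s) m t with hg
  have hgm : Measurable fun p : ℝ × ℝ => g p.1 p.2 := by
    simp only [hg, gaussianPDFReal]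
    fun_prop
  -- Log-ratio of the auxiliary conditional density of `x` given `y` to the density of `x`.
  set φ : ℝ × ℝ → ℝ := fun p => Real.log (g p.1 p.2) - L p.2 with hφ
  have hφm : Measurable φ := hgm.log.sub (hLm.comp measurable_snd)
  have hres : Integrable (fun ω => (x ω - (a + b * y ω)) ^ 2) P :=
    (hx.sub ((memLp_const a).add (hy.const_mul b))).integrable_sq
  have hgP : ∀ ω, Real.log (g (y ω) (x ω)) = -(1 / 2 * Real.log (2 * Real.pi * m))
      - (x ω - (a + b * y ω)) ^ 2 / (2 * m) := fun ω => log_gaussianPDFReal _ hm _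
  have hgint : Integrable (fun ω => Real.log (g (y ω) (x ω))) P := by
    simp only [hgP]
    exact (integrable_const _).sub (hres.div_const _)
  have hLint : Integrable (fun ω => L (x ω)) P :=
    ((integrable_log_density_iff hac).2 hint).comp_aemeasurable hxm
  have hφint : Integrable φ (P.map fun ω => (y ω, x ω)) := by
    rw [integrable_map_measure hφm.aestronglyMeasurable (hym.prodMk hxm)]
    exact hgint.sub hLint
  have hφval : ∫ p, φ p ∂(P.map fun ω => (y ω, x ω))
      = (∫ t, Real.negMulLog ((P.map x).rnDeriv volume t).toReal)
        - 1 / 2 * Real.log (2 * Real.pi * Real.exp 1 * m) := by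
    rw [integral_map (hym.prodMk hxm) hφm.aestronglyMeasurable]
    simp only [hφ]
    rw [integral_sub hgint hLint, ← integral_map hxm hLm.aestronglyMeasurable,
      integral_log_density hac]
    -- The quadratic term has mean `m / (2m) = 1/2`, the source of the factor `e` inside the
    -- logarithm.
    simp only [hgP]
    rw [integral_sub (integrable_const _) (hres.div_const _), integral_div, hmse,
      mul_right_comm _ (Real.exp 1), Real.log_mul (by positivity) (Real.exp_ne_zero _),
      Real.log_exp]
    simp
    field_simp
    ring
  have hlint : ∫⁻ p, ENNReal.ofReal (Real.exp (φ p)) ∂((P.map y).prod (P.map x)) ≤ 1 := by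
    rw [lintegral_prod _ (by fun_prop)]
    calc ∫⁻ s, ∫⁻ t, ENNReal.ofReal (Real.exp (φ (s, t))) ∂(P.map x) ∂(P.map y)
        ≤ ∫⁻ _, 1 ∂(P.map y) := by
          refine lintegral_mono fun s => ?_
          have hs : ∀ t, ENNReal.ofReal (Real.exp (φ (s, t)))
              = gaussianPDF (a + b * s) m t * ENNReal.ofReal (Real.exp (-L t)) := fun t => by
            simp only [hφ, hg]
            rw [sub_eq_add_neg, Real.exp_add, Real.exp_log (gaussianPDFReal_pos _ _ _ hm),
              ENNReal.ofReal_mul (gaussianPDFReal_nonneg _ _ _)]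
            rfl
          simp only [hs]
          exact (lintegral_mul_exp_neg_log_density_le hac (measurable_gaussianPDF _ _)).trans_eq
            (lintegral_gaussianPDF_eq_one _ hm)
      _ = 1 := by simp
  have hexp : Integrable (fun p => Real.exp (φ p)) ((P.map y).prod (P.map x)) :=
    ⟨hφm.exp.aestronglyMeasurable, by
      rw [hasFiniteIntegral_iff_ofReal (ae_of_all _ fun p => (Real.exp_pos _).le)]
      exact hlint.trans_lt ENNReal.one_lt_top⟩
  rw [← hφval]
  refine ofReal_integral_le_klDiv hφint hexp ?_
  rw [integral_eq_lintegral_of_nonneg_ae (ae_of_all _ fun p => (Real.exp_pos _).le)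
    hφm.exp.aestronglyMeasurable]
  exact ENNReal.toReal_le_of_le_ofReal zero_le_one (by simpa using hlint)

end Channel

/-! ### Bussgang decomposition -/

section Sndr

variable {μ : Measure ℝ} [IsProbabilityMeasure μ] {h : ℝ → ℝ}

theorem gain_eq_covariance_div (hid : MemLp id 2 μ) (hh : MemLp h 2 μ) (hmean : ∫ t, t ∂μ = 0) :
    gain μ h = cov[h, id; μ] / Var[id; μ] := by
  rw [gain, covariance_eq_sub hh hid, variance_eq_sub hid]
  simp [hmean, mul_comm]

theorem distortionPower_eq_variance (hid : MemLp id 2 μ) (hh : MemLp h 2 μ) :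
    distortionPower μ h = Var[distortion μ h; μ] := by
  have hd : MemLp (distortion μ h) 2 μ := hh.sub (hid.const_mul (gain μ h))
  rw [variance_eq_sub hd]
  rfl

/-- The gain is the regression coefficient of `h` on the centred input, so the distortion is
uncorrelated with the input and the variance of `h` splits. -/
theorem distortionPower_eq_sub (hid : MemLp id 2 μ) (hh : MemLp h 2 μ) (hmean : ∫ t, t ∂μ = 0)
    (hvar : Var[id; μ] ≠ 0) :
    distortionPower μ h = Var[h; μ] - cov[h, id; μ] ^ 2 / Var[id; μ] := by
  have hd : distortion μ h = h - fun t => gain μ h * id t := rfl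
  rw [distortionPower_eq_variance hid hh, hd, variance_sub hh (hid.const_mul _),
    covariance_const_mul_right, variance_const_mul, gain_eq_covariance_div hid hh hmean]
  field_simp
  ring

end Sndr

theorem memLp_of_range {α : Type*} {mα : MeasurableSpace α} {μ : Measure α} [IsFiniteMeasure μ]
    {A : ℝ} {h : ℝ → ℝ} (h_meas : Measurable h) (h_range : ∀ t, 0 ≤ h t ∧ h t ≤ A)
    {x : α → ℝ} (hx : AEMeasurable x μ) : MemLp (fun a => h (x a)) 2 μ :=
  memLp_of_bounded (a := 0) (b := A) (ae_of_all _ fun a => h_range (x a))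
    (h_meas.comp_aemeasurable hx).aestronglyMeasurable 2

/-! ### The lower bound for an arbitrary input -/

section Channel

variable {Ω : Type*} [MeasurableSpace Ω] {P : Measure Ω} [IsProbabilityMeasure P]

/-- The mean square error of the best affine estimate of a centred `x` from `y`. -/
theorem exists_affine_estimate {x y : Ω → ℝ} (hx : MemLp x 2 P) (hy : MemLp y 2 P)
    (hmean : ∫ ω, x ω ∂P = 0) (hvar : Var[y; P] ≠ 0) :
    ∃ a b : ℝ, ∫ ω, (x ω - (a + b * y ω)) ^ 2 ∂P
      = Var[x; P] - cov[x, y; P] ^ 2 / Var[y; P] := by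
  set b : ℝ := cov[x, y; P] / Var[y; P] with hb
  -- With the regression slope `b`, this intercept centres the residual, whose mean square is then
  -- its variance.
  refine ⟨-(b * ∫ ω, y ω ∂P), b, ?_⟩
  have hby : MemLp (fun ω => b * y ω) 2 P := hy.const_mul b
  have h1 : Var[fun ω => x ω - b * y ω; P] = Var[x; P] - cov[x, y; P] ^ 2 / Var[y; P] := by
    rw [variance_fun_sub hx hby, covariance_const_mul_right, variance_const_mul, hb]
    field_simp
    ring
  have hm : AEMeasurable (fun ω => x ω - b * y ω) P :=
    (hx.sub hby).aestronglyMeasurable.aemeasurable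
  rw [← h1, variance_eq_integral hm,
    integral_sub (hx.integrable one_le_two) (hby.integrable one_le_two), hmean,
    integral_const_mul]
  refine integral_congr_ae (ae_of_all _ fun ω => ?_)
  ring

theorem entropy_add_log_sndr_le_mutualInfo {A σx σv : ℝ} (hσx : 0 < σx) (hσv : 0 < σv)
    {h : ℝ → ℝ} (h_meas : Measurable h) (h_range : ∀ t, 0 ≤ h t ∧ h t ≤ A)
    {x v : Ω → ℝ} (hv : MemLp v 2 P) (hv_var : Var[v; P] = σv ^ 2)
    (hx : MemLp x 2 P) (hx_mean : ∫ ω, x ω ∂P = 0) (hx_var : Var[x; P] = σx ^ 2)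
    (hxv : IndepFun x v P) :
    differentialEntropy (P.map x)
        - ((1 / 2 * Real.log (2 * Real.pi * Real.exp 1 * σx ^ 2) : ℝ) : EReal)
        + ((1 / 2 * Real.log (1 + sndr (P.map x) h (σv ^ 2)) : ℝ) : EReal)
      ≤ (mutualInfo P (fun ω => h (x ω) + v ω) x : EReal) := by
  have hxm := hx.aestronglyMeasurable.aemeasurable
  have : IsProbabilityMeasure (P.map x) := Measure.isProbabilityMeasure_map hxm
  have hid : MemLp id 2 (P.map x) :=
    (memLp_map_measure_iff aestronglyMeasurable_id hxm).2 hx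
  by_cases hreg : P.map x ≪ volume ∧
      Integrable fun t => Real.negMulLog ((P.map x).rnDeriv volume t).toReal
  swap
  · rw [differentialEntropy_eq_bot_of_not_integrable hid hreg]
    simp
  obtain ⟨hac, hint⟩ := hreg
  have hhx : MemLp (fun ω => h (x ω)) 2 P := memLp_of_range h_meas h_range hxm
  have hh : MemLp h 2 (P.map x) := memLp_of_range h_meas h_range aemeasurable_id
  have hy : MemLp (fun ω => h (x ω) + v ω) 2 P := hhx.add hv
  have hind : IndepFun (fun ω => h (x ω)) v P := hxv.comp h_meas measurable_id
  have hmean : ∫ t, t ∂(P.map x) = 0 := by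
    rwa [integral_map (f := fun t : ℝ => t) hxm aestronglyMeasurable_id]
  have hidvar : Var[id; P.map x] = σx ^ 2 := by
    rw [variance_map aemeasurable_id hxm, Function.id_comp, hx_var]
  have hhvar : Var[h; P.map x] = Var[fun ω => h (x ω); P] :=
    variance_map h_meas.aemeasurable hxm
  have hcov : cov[h, id; P.map x] = cov[fun ω => h (x ω), x; P] :=
    covariance_map h_meas.aestronglyMeasurable aestronglyMeasurable_id hxm
  have hyvar : Var[fun ω => h (x ω) + v ω; P] = Var[fun ω => h (x ω); P] + σv ^ 2 := by
    rw [← hv_var]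
    exact hind.variance_add hhx hv
  have hycov : cov[x, fun ω => h (x ω) + v ω; P] = cov[fun ω => h (x ω), x; P] := by
    rw [covariance_comm (fun ω => h (x ω))]
    have h1 := covariance_add_right hx hhx hv
    rw [hxv.covariance_eq_zero hx hv, add_zero] at h1
    exact h1
  have hσx2 : 0 < σx ^ 2 := by positivity
  have hσv2 : 0 < σv ^ 2 := by positivity
  have hdp := distortionPower_eq_sub hid hh hmean (by rw [hidvar]; exact hσx2.ne')
  have hdp0 : 0 ≤ distortionPower (P.map x) h := by
    rw [distortionPower_eq_variance hid hh]
    exact variance_nonneg _ _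
  have hV0 : 0 ≤ Var[fun ω => h (x ω); P] := variance_nonneg _ _
  have hy0 : Var[fun ω => h (x ω) + v ω; P] ≠ 0 := by rw [hyvar]; positivity
  obtain ⟨a, b, hab⟩ := exists_affine_estimate hx hy hx_mean hy0
  rw [hx_var, hycov, hyvar] at hab
  rw [hhvar, hcov, hidvar] at hdp
  set c := cov[fun ω => h (x ω), x; P] with hc
  set V := Var[fun ω => h (x ω); P] with hV
  have hsndr : sndr (P.map x) h (σv ^ 2)
      = c ^ 2 / σx ^ 2 / (distortionPower (P.map x) h + σv ^ 2) := by
    rw [sndr, gain_eq_covariance_div hid hh hmean, hidvar, hcov]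
    field_simp
  have hsndr0 : 0 ≤ sndr (P.map x) h (σv ^ 2) := by rw [hsndr]; positivity
  -- With `D = ε_d + σv²`, the output variance is `D + c² / σx²`. Both sides are therefore `σx² D /
  -- (D + c² / σx²)`.
  have hmse : σx ^ 2 - c ^ 2 / (V + σv ^ 2) = σx ^ 2 / (1 + sndr (P.map x) h (σv ^ 2)) := by
    have hD : 0 < distortionPower (P.map x) h + σv ^ 2 := by positivity
    have hVD : V = distortionPower (P.map x) h + c ^ 2 / σx ^ 2 := by linarith
    have hVp : 0 < V + σv ^ 2 := by positivity
    rw [hsndr, one_add_div hD.ne', div_div_eq_mul_div, eq_div_iff (by positivity), hVD]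
    rw [hVD] at hVp
    field_simp
    ring
  set S := sndr (P.map x) h (σv ^ 2) with hS
  have hm0 : 0 < σx ^ 2 / (1 + S) := by positivity
  lift σx ^ 2 / (1 + S) to ℝ≥0 using hm0.le with m hm
  have key := ofReal_entropy_sub_le_mutualInfo hx hy hac hint a b
    (m := m) (by exact_mod_cast hm0.ne') (hab.trans hmse)
  have hlog : Real.log (2 * Real.pi * Real.exp 1 * m)
      = Real.log (2 * Real.pi * Real.exp 1 * σx ^ 2) - Real.log (1 + S) := by
    rw [hm, ← Real.log_div (by positivity) (by positivity), mul_div_assoc]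
  rw [hlog] at key
  rw [differentialEntropy_of_integrable hac hint, ← EReal.coe_sub, ← EReal.coe_add]
  refine le_trans ?_ (EReal.coe_ennreal_le_coe_ennreal_iff.2 key)
  rw [EReal.coe_ennreal_ofReal, EReal.coe_le_coe_iff]
  refine le_trans (le_of_eq ?_) (le_max_left _ _)
  ring

end Channel

/-! ### Gaussian input and capacities -/

theorem gaussianReal_mem_zeroMeanLaws (s : ℝ≥0) : gaussianReal 0 s ∈ zeroMeanLaws s :=
  ⟨inferInstance, memLp_id_gaussianReal 2, integral_id_gaussianReal, variance_id_gaussianReal⟩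

/-- The information rate of a Gaussian input. -/
theorem ofReal_log_sndr_le_informationRate_gaussianReal {A σx σv : ℝ} (hσx : 0 < σx) (hσv : 0 < σv)
    {h : ℝ → ℝ} (h_meas : Measurable h) (h_range : ∀ t, 0 ≤ h t ∧ h t ≤ A)
    {ν : Measure ℝ} [IsProbabilityMeasure ν] (hν : MemLp id 2 ν) (hν_var : Var[id; ν] = σv ^ 2) :
    ENNReal.ofReal
        (1 / 2 * Real.log (1 + sndr (gaussianReal 0 (σx ^ 2).toNNReal) h (σv ^ 2)))
      ≤ informationRate h ν (gaussianReal 0 (σx ^ 2).toNNReal) := by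
  set s : ℝ≥0 := (σx ^ 2).toNNReal with hs
  have hs_coe : (s : ℝ) = σx ^ 2 := Real.coe_toNNReal _ (sq_nonneg σx)
  have hs0 : s ≠ 0 := by
    rw [← NNReal.coe_ne_zero, hs_coe]
    positivity
  set μ := gaussianReal 0 s with hμ
  have hfst : (μ.prod ν).map Prod.fst = μ := measurePreserving_fst.map_eq
  have hsnd : (μ.prod ν).map Prod.snd = ν := measurePreserving_snd.map_eq
  have hx : MemLp Prod.fst 2 (μ.prod ν) :=
    (memLp_id_gaussianReal 2 : MemLp id 2 μ).comp_measurePreserving measurePreserving_fst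
  have hv : MemLp Prod.snd 2 (μ.prod ν) := hν.comp_measurePreserving measurePreserving_snd
  have hx_mean : ∫ p, p.1 ∂(μ.prod ν) = 0 := by
    rw [integral_fun_fst fun t : ℝ => t]
    simp [hμ]
  have hx_var : Var[Prod.fst; μ.prod ν] = σx ^ 2 := by
    have h1 := variance_map (X := id) (Y := Prod.fst) (μ := μ.prod ν) aemeasurable_id
      measurable_fst.aemeasurable
    rw [hfst, variance_id_gaussianReal, hs_coe] at h1
    exact h1.symm
  have hv_var : Var[Prod.snd; μ.prod ν] = σv ^ 2 := by
    have h1 := variance_map (X := id) (Y := Prod.snd) (μ := μ.prod ν) aemeasurable_id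
      measurable_snd.aemeasurable
    rw [hsnd, hν_var] at h1
    exact h1.symm
  have key := entropy_add_log_sndr_le_mutualInfo hσx hσv h_meas h_range hv hv_var hx hx_mean
    hx_var (indepFun_prod measurable_id measurable_id)
  rw [hfst, differentialEntropy_gaussianReal 0 hs0, hs_coe, ← EReal.coe_sub, sub_self,
    EReal.coe_zero, zero_add] at key
  rw [← EReal.coe_ennreal_le_coe_ennreal_iff, EReal.coe_ennreal_ofReal]
  -- `ENNReal.ofReal` truncates at 0; if the maximum is 0, nonnegativity of the information
  -- suffices.
  rcases max_cases (1 / 2 * Real.log (1 + sndr μ h (σv ^ 2))) 0 with ⟨h1, -⟩ | ⟨h1, -⟩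
  · rw [h1]
    exact key
  · rw [h1]
    exact EReal.coe_ennreal_nonneg _

end DynRange

theorem mainTheorem2 {Ω : Type*} [MeasurableSpace Ω] (P : Measure Ω) [IsProbabilityMeasure P]
    (A σx σv : ℝ) (hσx : 0 < σx) (hσv : 0 < σv)
    (h : ℝ → ℝ) (h_meas : Measurable h) (h_range : ∀ t, 0 ≤ h t ∧ h t ≤ A)
    (v : Ω → ℝ) (hv : MemLp v 2 P) (hv_mean : ∫ ω, v ω ∂P = 0) (hv_var : Var[v; P] = σv ^ 2) :
    (∀ x : Ω → ℝ, MemLp x 2 P → ∫ ω, x ω ∂P = 0 → Var[x; P] = σx ^ 2 → IndepFun x v P →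
      DynRange.differentialEntropy (P.map x)
          - ((1 / 2 * Real.log (2 * Real.pi * Real.exp 1 * σx ^ 2) : ℝ) : EReal)
          + ((1 / 2 * Real.log (1 + DynRange.sndr (P.map x) h (σv ^ 2)) : ℝ) : EReal)
        ≤ (DynRange.mutualInfo P (fun ω => h (x ω) + v ω) x : EReal)) ∧
    ENNReal.ofReal
        (1 / 2 * Real.log (1 + DynRange.sndr (gaussianReal 0 (σx ^ 2).toNNReal) h (σv ^ 2)))
      ≤ DynRange.capacityWithPower h (P.map v) (σx ^ 2) ∧
    ENNReal.ofReal
        (1 / 2 * Real.log (1 + DynRange.sndr (gaussianReal 0 (σx ^ 2).toNNReal) h (σv ^ 2)))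
      ≤ DynRange.capacity h (P.map v) ∧
    ENNReal.ofReal
        (1 / 2 * Real.log (1 + DynRange.sndr (gaussianReal 0 (σx ^ 2).toNNReal) h (σv ^ 2)))
      ≤ DynRange.dynamicRangeCapacity A (P.map v) := by
  have hvm := hv.aestronglyMeasurable.aemeasurable
  have : IsProbabilityMeasure (P.map v) := Measure.isProbabilityMeasure_map hvm
  have hν : MemLp id 2 (P.map v) := (memLp_map_measure_iff aestronglyMeasurable_id hvm).2 hv
  have hν_var : Var[id; P.map v] = σv ^ 2 := by
    rw [variance_map aemeasurable_id hvm, Function.id_comp, hv_var]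
  have hG := DynRange.ofReal_log_sndr_le_informationRate_gaussianReal hσx hσv h_meas h_range hν
    hν_var
  have hmem : gaussianReal 0 (σx ^ 2).toNNReal ∈ DynRange.zeroMeanLaws (σx ^ 2) := by
    have h1 := DynRange.gaussianReal_mem_zeroMeanLaws (σx ^ 2).toNNReal
    rwa [Real.coe_toNNReal _ (sq_nonneg σx)] at h1
  have hC : DynRange.informationRate h (P.map v) (gaussianReal 0 (σx ^ 2).toNNReal)
      ≤ DynRange.capacity h (P.map v) :=
    le_iSup₂ (f := fun μ (_ : μ ∈ {μ : Measure ℝ | IsProbabilityMeasure μ}) =>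
      DynRange.informationRate h (P.map v) μ) _ hmem.1
  refine ⟨fun x hx hx_mean hx_var hxv =>
    DynRange.entropy_add_log_sndr_le_mutualInfo hσx hσv h_meas h_range hv hv_var hx hx_mean
      hx_var hxv, ?_, hG.trans hC, (hG.trans hC).trans ?_⟩
  · exact hG.trans (le_iSup₂ (f := fun μ (_ : μ ∈ DynRange.zeroMeanLaws (σx ^ 2)) =>
      DynRange.informationRate h (P.map v) μ) _ hmem)
  · exact le_iSup₂ (f := fun k (_ : k ∈ DynRange.rangeLimited A) =>
      DynRange.capacity k (P.map v)) h ⟨h_meas, h_range⟩
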